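/- Let $p\ge 0$, $w\ge 1$, $n\ge 1$ be integers, let $a_p,z_1,\ldots,z_w\in\mathbb{C}$ with $a_p\ne 0$, and let $a(t)=\sum_{k=p-w}^{p}a_kt^k=a_p\,t^{p-w}\prod_{j=1}^{w}(t-z_j)$, with $a_k=0$ for $k>p$ and for $k<p-w$. Let $T_n(a)=[a_{j-k}]_{j,k=1}^{n}$ be the corresponding banded Toeplitz matrix. Let $h_k$ be the complete homogeneous symmetric polynomial of degree $k$ in $w$ variables (so $h_0=1$), with $h_k=0$ for $k<0$. For partitions $\lambda,\mu$ (weakly decreasing tuples of nonnegative integers, extended by zeros when needed) let $s_{\lambda/\mu}=\det[h_{\lambda_j-\mu_k-j+k}]_{j,k=1}^{\ell(\lambda)}$ be the skew Schur polynomial if $\mu_j\le\lambda_j$ for all $j$, and $s_{\lambda/\mu}=0$ otherwise, where $\ell(\lambda)$ is the number of entries of the tuple $\lambda$; let $s_\lambda=s_{\lambda/()}$ be the Schur polynomial. In subscripts, a comma denotes concatenation of tuples and $m^q$ denotes $m$ repeated $q$ times. All these polynomials are evaluated at $(z_1,\ldots,z_w)$. Then for all $r,s\in\{1,\ldots,n\}$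 the entry $(r,s)$ of the adjugate matrix of $T_n(a)$ satisfies $$\operatorname{adj}(T_n(a))_{r,s}=(-1)^{p(n-1)}\,a_p^{n-1}\,s_{((n-1)^p,\,s-1)/(r-1)},$$ $$\operatorname{adj}(T_n(a))_{r,s}=(-1)^{p(n-1)}\,a_p^{n-1}\,s_{((n-1)^p,\,n-r)/(n-s)},$$ $$\operatorname{adj}(T_n(a))_{r,s}=(-1)^{p(n-1)}\,a_p^{n-1}\sum_{k=\max(0,\,s-r)}^{\min(n-r,\,s-1)}s_{((n-1)^{p-1},\,n+s-r-1-k,\,k)}\qquad\text{if } p\ge 1,$$ $$\operatorname{adj}(T_n(a))_{r,s}=(-1)^{pn}\,a_p^{n-1}\left(h_{s-r-p}\,s_{(n^p)}-\sum_{k=0}^{p-1}(-1)^k\,h_{s+k-p}\,s_{(n^{p-k-1},\,(n-1)^k,\,n-r)}\right).$$ -/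

import Mathlib

open scoped LaurentPolynomial

noncomputable section

namespace BandedToeplitz

/-- The complete homogeneous symmetric polynomial `h_k` in `w` variables, indexed by all integers:
it is zero for `k < 0`. -/
def completeHomogeneous (w : ℕ) (k : ℤ) : MvPolynomial (Fin w) ℂ :=
  if 0 ≤ k then MvPolynomial.hsymm (Fin w) ℂ k.toNat else 0

/-- The `j`-th entry (counted from `0`) of a tuple, extended by zeros. -/
def part (l : List ℕ) (j : ℕ) : ℕ := l.getD j 0

/-- The Jacobi-Trudi matrix `[h_{l_j - m_k - j + k}]` of size `ℓ(l)`; the tuple `m` is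
extended by zeros. -/
def jacobiTrudi (w : ℕ) (l m : List ℕ) :
    Matrix (Fin l.length) (Fin l.length) (MvPolynomial (Fin w) ℂ) :=
  Matrix.of fun j k =>
    completeHomogeneous w ((part l j : ℤ) - (part m k : ℤ) - ((j : ℕ) : ℤ) + ((k : ℕ) : ℤ))

open Classical in
/-- The skew Schur polynomial `s_{l/m}` in `w` variables, for partitions `l`, `m` written as weakly
decreasing tuples: the Jacobi-Trudi determinant if `m ⊆ l`, and zero if `l / m` is not a
skew partition. -/
def skewSchur (w : ℕ) (l m : List ℕ) : MvPolynomial (Fin w) ℂ :=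
  if ∀ j, part m j ≤ part l j then (jacobiTrudi w l m).det else 0

/-- The Schur polynomial `s_l` in `w` variables. -/
def schur (w : ℕ) (l : List ℕ) : MvPolynomial (Fin w) ℂ := skewSchur w l []

/-- The Toeplitz matrix `T_n(a) = [a_{j-k}]` generated by a Laurent polynomial `a`. -/
def toeplitz (n : ℕ) (a : ℂ[T;T⁻¹]) : Matrix (Fin n) (Fin n) ℂ :=
  Matrix.of fun j k => a.coeff (((j : ℕ) : ℤ) - ((k : ℕ) : ℤ))

end BandedToeplitz

end

namespace BandedToeplitz

/-! Put `f = ∏ (1 - z_j X)`. Since `t - z = t (1 - z t⁻¹)`, the coefficient `a_k` is `a_p` times the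
coefficient of `X^(p-k)` in `f`, and `1 / f` generates the `h_k`. So the transpose of `T_n(a) / a_p`
is the corner of rows `p, ..., p+n-1` and columns `0, ..., n-1` in the unitriangular Toeplitz matrix
of `f` of size `n + p`, whose inverse is the Toeplitz matrix of the `h_k`. Jacobi's complementary
minor identity (`adjugate_toBlocks₁₁_of_mul_eq_one`) turns each cofactor into a minor of order `p +
1` in the `h_k` (`adjugate_extCoeff`).

All four formulas read off this one minor. A cyclic shift of its columns after transposition gives
the second (`det_bordered_eq_det_rect`); rotating the skew shape by 180 degrees gives the first
(`det_rect_reflect`); a Pieri-type recursion gives the third (`rectSkewDet_eq_sum`); Laplace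
expansion along the last row gives the fourth (`det_bordered_expand`). -/

/-- The coefficients of a power series, extended by zero to negative indices. -/
noncomputable def extCoeff {R : Type*} [CommRing R] (f : PowerSeries R) (k : ℤ) : R :=
  if 0 ≤ k then PowerSeries.coeff k.toNat f else 0

/-! ### Generating functions and triangular Toeplitz matrices -/

section Series
variable {R : Type*} [CommRing R]

lemma extCoeff_of_neg (f : PowerSeries R) {k : ℤ} (hk : k < 0) : extCoeff f k = 0 := by
  simp [extCoeff, hk]

lemma extCoeff_natCast (f : PowerSeries R) (k : ℕ) : extCoeff f k = PowerSeries.coeff k f := by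
  simp [extCoeff]

/-- Lower triangular Toeplitz matrices multiply like the generating power series. -/
lemma sum_extCoeff_mul_extCoeff (f g : PowerSeries R) {N : ℕ} (i k : Fin N) :
    ∑ j : Fin N, extCoeff f ((i : ℤ) - (j : ℤ)) * extCoeff g ((j : ℤ) - (k : ℤ)) =
      extCoeff (f * g) ((i : ℤ) - (k : ℤ)) := by
  by_cases hik : (k : ℕ) ≤ i
  · obtain ⟨d, hd⟩ := Nat.exists_eq_add_of_le hik
    have h1 : ((i : ℤ) - (k : ℤ)) = (d : ℕ) := by omega
    rw [h1, extCoeff_natCast, PowerSeries.coeff_mul]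
    symm
    -- Only indices `k ≤ j ≤ i` contribute, so the finite size `N` cuts nothing off the convolution.
    refine Finset.sum_bij_ne_zero (fun x hx _ => (⟨k + x.2, ?_⟩ : Fin N)) ?_ ?_ ?_ ?_
    · have := Finset.HasAntidiagonal.mem_antidiagonal.1 hx; omega
    · simp
    · intro a ha _ b hb _ hab
      have := Finset.HasAntidiagonal.mem_antidiagonal.1 ha
      have := Finset.HasAntidiagonal.mem_antidiagonal.1 hb
      simp only [Fin.mk.injEq] at hab
      ext <;> omega
    · intro j _ hj
      have hj1 : (j : ℕ) ≤ i := by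
        by_contra hc
        exact hj (by rw [extCoeff_of_neg f (by omega), zero_mul])
      have hj2 : (k : ℕ) ≤ j := by
        by_contra hc
        exact hj (by rw [extCoeff_of_neg g (by omega), mul_zero])
      obtain ⟨u, hu⟩ := Nat.exists_eq_add_of_le hj1
      obtain ⟨v, hv⟩ := Nat.exists_eq_add_of_le hj2
      refine ⟨(u, v), ?_, ?_, ?_⟩
      · simp; omega
      · have e1 : ((i : ℤ) - (j : ℤ)) = (u : ℕ) := by omega
        have e2 : ((j : ℤ) - (k : ℤ)) = (v : ℕ) := by omega
        rwa [e1, e2, extCoeff_natCast, extCoeff_natCast] at hj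
      · ext; simp; omega
    · intro a ha _
      have := Finset.HasAntidiagonal.mem_antidiagonal.1 ha
      have e1 : ((i : ℤ) - ((k : ℕ) + a.2 : ℕ)) = (a.1 : ℕ) := by omega
      have e2 : ((((k : ℕ) + a.2 : ℕ) : ℤ) - (k : ℤ)) = (a.2 : ℕ) := by omega
      simp only [e1, e2, extCoeff_natCast]
  · rw [extCoeff_of_neg _ (by omega)]
    refine Finset.sum_eq_zero fun j _ => ?_
    rcases lt_or_ge (i : ℕ) j with h | h
    · rw [extCoeff_of_neg f (by omega), zero_mul]
    · rw [extCoeff_of_neg g (by omega), mul_zero]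

lemma extCoeff_one (k : ℤ) : extCoeff (1 : PowerSeries R) k = if k = 0 then 1 else 0 := by
  rcases lt_or_ge k 0 with h | h
  · rw [extCoeff_of_neg _ h, if_neg (by omega)]
  · lift k to ℕ using h
    rw [extCoeff_natCast, PowerSeries.coeff_one]
    simp

/-- The generating function of the complete homogeneous symmetric polynomials. -/
lemma mk_eval_hsymm {σ : Type*} [Fintype σ] [DecidableEq σ] (z : σ → R) :
    PowerSeries.mk (fun k => MvPolynomial.eval z (MvPolynomial.hsymm σ R k)) =
      ∏ j, PowerSeries.mk (fun k => z j ^ k) := by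
  ext n
  rw [PowerSeries.coeff_mk, PowerSeries.coeff_prod, MvPolynomial.hsymm, map_sum]
  refine Finset.sum_bij' (fun s _ => Multiset.toFinsupp s.1)
    (fun l hl => ⟨Finsupp.toMultiset l, ?_⟩) ?_ ?_ ?_ ?_ ?_
  · have := (Finset.mem_finsuppAntidiag.1 hl).1
    rw [Finsupp.card_toMultiset, Finsupp.sum_fintype _ _ (fun _ => rfl)]
    exact this
  · intro s _
    rw [Finset.mem_finsuppAntidiag]
    refine ⟨?_, Finset.subset_univ _⟩
    have := Multiset.toFinsupp_sum_eq s.1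
    rw [Finsupp.sum_fintype _ _ (fun _ => rfl)] at this
    exact this.trans s.2
  · exact fun _ _ => Finset.mem_univ _
  · intro s _
    ext; simp
  · intro l _
    simp
  · intro s _
    simp only [PowerSeries.coeff_mk, Multiset.toFinsupp_apply, map_multiset_prod, Multiset.map_map]
    rw [Finset.prod_multiset_map_count]
    refine Finset.prod_subset (Finset.subset_univ _) ?_ |>.trans ?_
    · intro x _ hx
      rw [Multiset.mem_toFinset] at hx
      exact (congrArg _ (Multiset.count_eq_zero_of_notMem hx)).trans (pow_zero _)
    · simp

lemma mk_pow_mul_one_sub (c : R) :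
    PowerSeries.mk (fun k => c ^ k) * (1 - PowerSeries.C c * PowerSeries.X) = 1 := by
  ext n
  rw [mul_sub, mul_one, mul_comm (PowerSeries.C c), ← mul_assoc, map_sub, PowerSeries.coeff_mul_C]
  cases n with
  | zero => simp
  | succ n => simp [PowerSeries.coeff_succ_mul_X, PowerSeries.coeff_one, pow_succ]

lemma prod_one_sub_mul_mk_eval_hsymm {σ : Type*} [Fintype σ] [DecidableEq σ] (z : σ → R) :
    (∏ j, (1 - PowerSeries.C (z j) * PowerSeries.X)) *
      PowerSeries.mk (fun k => MvPolynomial.eval z (MvPolynomial.hsymm σ R k)) = 1 := by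
  rw [mk_eval_hsymm, mul_comm, ← Finset.prod_mul_distrib]
  exact Finset.prod_eq_one fun j _ => mk_pow_mul_one_sub _

lemma eval_completeHomogeneous {w : ℕ} (z : Fin w → ℂ) (k : ℤ) :
    MvPolynomial.eval z (completeHomogeneous w k) =
      extCoeff (PowerSeries.mk fun k => MvPolynomial.eval z (MvPolynomial.hsymm (Fin w) ℂ k)) k := by
  unfold completeHomogeneous extCoeff
  split_ifs <;> simp

lemma coeff_invert_toLaurent (q : Polynomial R) (k : ℤ) :
    (LaurentPolynomial.invert (Polynomial.toLaurent q)).coeff (-k) =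
      extCoeff (q : PowerSeries R) k := by
  rw [LaurentPolynomial.invert_apply, neg_neg, LaurentPolynomial.coeff_toLaurent]
  rcases lt_or_ge k 0 with h | h
  · rw [extCoeff_of_neg _ h, Finsupp.mapDomain_of_notMem_range]
    rintro ⟨m, hm⟩
    simp at hm; omega
  · lift k to ℕ using h
    rw [extCoeff_natCast, Polynomial.coeff_coe]
    exact Finsupp.mapDomain_apply Nat.castEmbedding.injective _ _

/-- The coefficients of `T ^ (p - w) * ∏ (T - z j)` in terms of those of `∏ (1 - z j X)`. -/
lemma coeff_T_mul_prod {w : ℕ} (c : R) (z : Fin w → R) (p k : ℤ) :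
    (LaurentPolynomial.C c * LaurentPolynomial.T (p - (w : ℤ)) *
      ∏ j : Fin w, (LaurentPolynomial.T 1 - LaurentPolynomial.C (z j)) : R[T;T⁻¹]).coeff k =
      c * extCoeff (∏ j, (1 - PowerSeries.C (z j) * PowerSeries.X)) (p - k) := by
  have h1 : ∏ j : Fin w, (LaurentPolynomial.T 1 - LaurentPolynomial.C (z j) : R[T;T⁻¹]) =
      LaurentPolynomial.T (w : ℤ) * LaurentPolynomial.invert
        (Polynomial.toLaurent (∏ j, (1 - Polynomial.C (z j) * Polynomial.X))) := by
    have h2 : (LaurentPolynomial.T (w : ℤ) : R[T;T⁻¹]) = ∏ _j : Fin w, LaurentPolynomial.T 1 := by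
      simp [LaurentPolynomial.T_pow]
    rw [h2, map_prod, map_prod, ← Finset.prod_mul_distrib]
    refine Finset.prod_congr rfl fun j _ => ?_
    simp only [map_sub, map_one, map_mul, Polynomial.toLaurent_C, Polynomial.toLaurent_X,
      LaurentPolynomial.invert_C, LaurentPolynomial.invert_T]
    rw [mul_sub, mul_one, mul_left_comm, ← LaurentPolynomial.T_add]
    simp
  rw [h1, mul_assoc, ← mul_assoc (LaurentPolynomial.T _), ← LaurentPolynomial.T_add,
    sub_add_cancel]
  have h3 : ((∏ j, (1 - Polynomial.C (z j) * Polynomial.X) : Polynomial R) : PowerSeries R) =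
      ∏ j, (1 - PowerSeries.C (z j) * PowerSeries.X) := by
    rw [← Polynomial.coeToPowerSeries.ringHom_apply, map_prod]
    simp
  rw [← h3, ← coeff_invert_toLaurent]
  generalize LaurentPolynomial.invert (Polynomial.toLaurent
    (∏ j, (1 - Polynomial.C (z j) * Polynomial.X))) = f
  rw [← LaurentPolynomial.single_eq_C, LaurentPolynomial.T,
    AddMonoidAlgebra.coeff_single_mul_eq_mul_coeff k (by simp),
    AddMonoidAlgebra.coeff_single_mul_eq_mul_coeff (k - p)
      (fun m' _ => by rw [eq_sub_iff_add_eq, add_comm]), one_mul, neg_sub]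

end Series

/-! ### Moving a block of rows and its sign -/

lemma val_finRotate_pow (N q : ℕ) (i : Fin N) :
    (((finRotate N) ^ q) i : ℕ) = ((i : ℕ) + q) % N := by
  induction q with
  | zero => simp [Nat.mod_eq_of_lt i.2]
  | succ q ih =>
    rw [pow_succ', Equiv.Perm.mul_apply]
    obtain _ | m := N
    · exact i.elim0
    · rw [finRotate_apply, Fin.val_add, ih, Fin.val_one', ← Nat.add_mod, add_assoc]

/-- The bijection that lists the last `n` elements of `Fin (n + p)` before the first `p`. -/
def flippedSumEquiv (n p : ℕ) : Fin n ⊕ Fin p ≃ Fin (n + p) :=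
  ((Equiv.sumComm _ _).trans finSumFinEquiv).trans (finCongr (add_comm p n))

@[simp] lemma val_flippedSumEquiv_inl {n p : ℕ} (i : Fin n) :
    (flippedSumEquiv n p (Sum.inl i) : ℕ) = p + i := by
  simp [flippedSumEquiv, add_comm]

@[simp] lemma val_flippedSumEquiv_inr {n p : ℕ} (i : Fin p) :
    (flippedSumEquiv n p (Sum.inr i) : ℕ) = i := by
  simp [flippedSumEquiv]

lemma sign_finRotate_pow (n p : ℕ) :
    Equiv.Perm.sign ((finRotate (n + p)) ^ p) = (-1) ^ (n * p) := by
  rw [map_pow, sign_finRotate, ← pow_mul]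
  obtain _ | p := p
  · simp
  · rw [show (n + (p + 1) - 1) * (p + 1) = n * (p + 1) + p * (p + 1) by
      rw [← add_assoc, Nat.add_sub_cancel]; ring, pow_add, (Nat.even_mul_succ_self p).neg_one_pow,
      mul_one]

/-! ### Jacobi's complementary minor identity -/

section Core
variable {R : Type*} [CommRing R]

lemma det_submatrix_flippedSumEquiv {n p : ℕ} (A : Matrix (Fin (n + p)) (Fin (n + p)) R) :
    (A.submatrix (flippedSumEquiv n p) finSumFinEquiv).det = (-1) ^ (n * p) * A.det := by
  have h : flippedSumEquiv n p = finSumFinEquiv.trans ((finRotate (n + p)) ^ p) := by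
    ext x
    rw [Equiv.trans_apply, val_finRotate_pow]
    rcases x with x | x
    · have := x.2
      rw [val_flippedSumEquiv_inl, finSumFinEquiv_apply_left, Fin.val_castAdd,
        Nat.mod_eq_of_lt (by omega), add_comm]
    · have := x.2
      rw [val_flippedSumEquiv_inr, finSumFinEquiv_apply_right, Fin.val_natAdd,
        show n + (x : ℕ) + p = x + (n + p) by ring, Nat.add_mod_right, Nat.mod_eq_of_lt (by omega)]
  have h2 : A.submatrix (flippedSumEquiv n p) finSumFinEquiv =
      (A.submatrix ((finRotate (n + p)) ^ p : Equiv.Perm _) id).submatrix finSumFinEquiv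
        finSumFinEquiv := by
    rw [h]; rfl
  rw [h2, Matrix.det_submatrix_equiv_self, Matrix.det_permute, sign_finRotate_pow]
  simp

lemma det_extCoeff_of_coeff_zero (f : PowerSeries R) (hf : PowerSeries.coeff 0 f = 1) (N : ℕ) :
    (Matrix.of fun i j : Fin N => extCoeff f ((i : ℤ) - (j : ℤ))).det = 1 := by
  rw [Matrix.det_of_isLowerTriangular _ fun i j (hij : i < j) => by
    rw [Matrix.of_apply, extCoeff_of_neg]
    have : (i : ℕ) < j := hij
    omega]
  refine Finset.prod_eq_one fun i _ => ?_
  simp [extCoeff, hf]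

lemma adjugate_apply_eq_det_updateCol {m : Type*} [Fintype m] [DecidableEq m]
    (A : Matrix m m R) (i j : m) :
    A.adjugate i j = (A.updateCol i (Pi.single j 1)).det := by
  rw [← Matrix.transpose_apply A.adjugate, Matrix.adjugate_transpose, Matrix.adjugate_apply,
    Matrix.updateRow_transpose, Matrix.det_transpose]

/-- Cofactors of a corner block of a matrix, expressed by minors of the inverse matrix. -/
lemma adjugate_toBlocks₁₁_of_mul_eq_one {n p : ℕ}
    (M M' : Matrix (Fin n ⊕ Fin p) (Fin n ⊕ Fin p) R) (h : M * M' = 1) (i j : Fin n) :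
    M.toBlocks₁₁.adjugate j i = M.det * (Matrix.of fun a b : Fin (p + 1) =>
      M' (if h : (a : ℕ) < p then Sum.inr ⟨a, h⟩ else Sum.inl j)
        (if h : (b : ℕ) < p then Sum.inr ⟨b, h⟩ else Sum.inl i)).det := by
  classical
  -- `K` is chosen so that `M * K` has identity columns in the second block and, in the first, the
  -- columns of `M` with column `j` replaced by the `i`-th unit vector. Its determinant is then the
  -- cofactor, while `K` itself reduces to a minor of `M'` once its unit columns are split off.
  let K : Matrix (Fin n ⊕ Fin p) (Fin n ⊕ Fin p) R := Matrix.of fun α => Sum.elim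
    (fun j' => if j' = j then M' α (Sum.inl i) else if α = Sum.inl j' then 1 else 0)
    (fun b => M' α (Sum.inr b))
  have hM (α β) : ∑ γ, M α γ * M' γ β = if α = β then 1 else 0 := by
    rw [← Matrix.mul_apply, h, Matrix.one_apply]
  have h1 : M * K = Matrix.fromBlocks (M.toBlocks₁₁.updateCol j (Pi.single i 1)) 0
      (M.toBlocks₂₁.updateCol j 0) 1 := by
    ext α β
    rw [Matrix.mul_apply]
    rcases β with β | β
    · by_cases hβ : β = j
      · subst hβ
        simp only [K, Matrix.of_apply, Sum.elim_inl, if_true, hM]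
        rcases α with α | α
        · simp [Pi.single_apply]
        · simp
      · simp only [K, Matrix.of_apply, Sum.elim_inl, if_neg hβ]
        rcases α with α | α <;> simp [hβ, Matrix.toBlocks₁₁, Matrix.toBlocks₂₁]
    · simp only [K, Matrix.of_apply, Sum.elim_inr, hM]
      rcases α with α | α <;> simp [Matrix.one_apply]
  have h2 : M.toBlocks₁₁.adjugate j i = M.det * K.det := by
    rw [← Matrix.det_mul, h1, Matrix.det_fromBlocks_zero₁₂, Matrix.det_one, mul_one,
      adjugate_apply_eq_det_updateCol]
  rw [h2, Matrix.twoBlockTriangular_det K (fun β => ∃ j', j' ≠ j ∧ β = Sum.inl j')]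
  · have h3 : Matrix.toSquareBlockProp K (fun β => ∃ j', j' ≠ j ∧ β = Sum.inl j') = 1 := by
      ext ⟨α, hα⟩ ⟨β, j', hj', rfl⟩
      simp [Matrix.toSquareBlockProp, K, hj', Matrix.one_apply]
    let φ : Fin (p + 1) → {β : Fin n ⊕ Fin p // ¬ ∃ j', j' ≠ j ∧ β = Sum.inl j'} := fun a =>
      ⟨if h : (a : ℕ) < p then Sum.inr ⟨a, h⟩ else Sum.inl j, by
        split_ifs <;> simp +contextual [eq_comm]⟩
    have hφ : Function.Bijective φ := by
      constructor
      · intro a b hab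
        have ha := a.2
        have hb := b.2
        simp only [φ, Subtype.mk.injEq] at hab
        ext
        split_ifs at hab
        · simpa using hab
        · omega
      · rintro ⟨β | β, hβ⟩
        · refine ⟨Fin.last p, ?_⟩
          have : β = j := by
            by_contra hc
            exact hβ ⟨β, hc, rfl⟩
          simp [φ, this]
        · exact ⟨β.castSucc, by simp [φ]⟩
    rw [h3, Matrix.det_one, one_mul, ← Matrix.det_submatrix_equiv_self (Equiv.ofBijective φ hφ)]
    congr 2
    ext a b
    simp only [Matrix.submatrix_apply, Equiv.ofBijective_apply, Matrix.toSquareBlockProp,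
      Matrix.of_apply, φ, K]
    by_cases ha : (a : ℕ) < p <;> by_cases hb : (b : ℕ) < p <;> simp [ha, hb]
  · rintro α hα β ⟨j', hj', rfl⟩
    have : α ≠ Sum.inl j' := fun hc => hα ⟨j', hj', hc⟩
    simp [K, hj', this]

/-- Cofactors of a banded Toeplitz matrix as minors of the inverse triangular Toeplitz matrix. -/
lemma adjugate_extCoeff {f g : PowerSeries R} (hfg : f * g = 1)
    (hf : PowerSeries.coeff 0 f = 1) (n p : ℕ) (i j : Fin n) :
    (Matrix.of fun a b : Fin n => extCoeff f ((p : ℤ) + (a : ℤ) - (b : ℤ))).adjugate j i =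
      (-1) ^ (n * p) * (Matrix.of fun a b : Fin (p + 1) => extCoeff g
        ((if (a : ℕ) < p then (n : ℤ) + (a : ℤ) else (j : ℤ)) -
          (if (b : ℕ) < p then (b : ℤ) else (p : ℤ) + (i : ℤ)))).det := by
  let E : Matrix (Fin (n + p)) (Fin (n + p)) R :=
    Matrix.of fun i j => extCoeff f ((i : ℤ) - (j : ℤ))
  let H : Matrix (Fin (n + p)) (Fin (n + p)) R :=
    Matrix.of fun i j => extCoeff g ((i : ℤ) - (j : ℤ))
  have hEH : E * H = 1 := by
    ext i k
    rw [Matrix.mul_apply]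
    simp only [E, H, Matrix.of_apply, sum_extCoeff_mul_extCoeff, hfg, extCoeff_one,
      Matrix.one_apply, sub_eq_zero, Fin.ext_iff, Nat.cast_inj]
  have hM : E.submatrix (flippedSumEquiv n p) finSumFinEquiv *
      H.submatrix finSumFinEquiv (flippedSumEquiv n p) = 1 := by
    rw [Matrix.submatrix_mul_equiv, hEH, Matrix.submatrix_one_equiv]
  have key := adjugate_toBlocks₁₁_of_mul_eq_one _ _ hM i j
  rw [det_submatrix_flippedSumEquiv, det_extCoeff_of_coeff_zero f hf, mul_one] at key
  convert key using 2
  · ext a b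
    simp [Matrix.toBlocks₁₁, E]
  · congr 1
    ext a b
    simp only [Matrix.of_apply, H, Matrix.submatrix_apply]
    split_ifs <;> simp

end Core

/-! ### A Pieri-type rule for a rectangle with one extra row -/

section Pieri
variable {R : Type*} [CommRing R]

/-- The determinant is linear in the column `c`, and all other columns are constant series. -/
lemma coeff_det_updateCol {N : ℕ} (A : Matrix (Fin N) (Fin N) R) (c : Fin N)
    (v : Fin N → PowerSeries R) (m : ℕ) :
    PowerSeries.coeff m (((A.map PowerSeries.C).updateCol c v).det) =
      (A.updateCol c fun i => PowerSeries.coeff m (v i)).det := by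
  rw [← Matrix.cramer_apply, ← Matrix.cramer_apply, Matrix.cramer_eq_adjugate_mulVec,
    Matrix.cramer_eq_adjugate_mulVec, ← RingHom.mapMatrix_apply, ← RingHom.map_adjugate]
  simp [Matrix.mulVec, dotProduct, map_sum]

lemma coeff_det_updateRow {N : ℕ} (A : Matrix (Fin N) (Fin N) R) (c : Fin N)
    (v : Fin N → PowerSeries R) (m : ℕ) :
    PowerSeries.coeff m (((A.map PowerSeries.C).updateRow c v).det) =
      (A.updateRow c fun i => PowerSeries.coeff m (v i)).det := by
  rw [← Matrix.det_transpose, ← Matrix.updateCol_transpose, ← Matrix.transpose_map,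
    coeff_det_updateCol, Matrix.updateCol_transpose, Matrix.det_transpose]

/-- Reflection in the antidiagonal; on Jacobi-Trudi matrices it is the rotation of the skew shape by
180 degrees. -/
lemma det_of_rev_rev {N : ℕ} (A : Fin N → Fin N → R) :
    (Matrix.of fun i j => A (Fin.rev j) (Fin.rev i)).det = (Matrix.of A).det := by
  rw [← Matrix.det_transpose (Matrix.of A), ← Matrix.det_submatrix_equiv_self Fin.revPerm]
  congr 1
  ext
  simp

/-- The Jacobi-Trudi determinant of the skew shape `(A ^ (q + 1), B) / (m)`. -/
def rectSkewDet (h : ℤ → R) (q : ℕ) (A m B : ℤ) : R :=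
  (Matrix.of fun j k : Fin (q + 2) =>
    h ((if (j : ℕ) ≤ q then A else B) - (if (k : ℕ) = 0 then m else 0) - (j : ℤ) + (k : ℤ))).det

/-- The Jacobi-Trudi determinant of the shape `(A ^ q, X, B)`. -/
def rectTwoDet (h : ℤ → R) (q : ℕ) (A X B : ℤ) : R :=
  (Matrix.of fun j k : Fin (q + 2) =>
    h ((if (j : ℕ) < q then A else if (j : ℕ) = q then X else B) - (j : ℤ) + (k : ℤ))).det

variable (h : ℤ → R) (q : ℕ) (A : ℤ)

/-- Not a consequence of `rectTwoDet_swap`, which only shows that twice the value vanishes. -/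
lemma rectTwoDet_self_add_one (X : ℤ) : rectTwoDet h q A X (X + 1) = 0 := by
  refine Matrix.det_zero_of_row_eq (i := ⟨q, by omega⟩) (j := Fin.last _) ?_ ?_
  · simp [Fin.ext_iff]
  · ext k
    simp only [Matrix.of_apply, Fin.val_last]
    congr 1
    split_ifs <;> omega

/-- Straightening rule: the last two rows are exchanged, and their offsets differ by one. -/
lemma rectTwoDet_swap (X B : ℤ) :
    rectTwoDet h q A X B = - rectTwoDet h q A (B - 1) (X + 1) := by
  have hne : (⟨q, by omega⟩ : Fin (q + 2)) ≠ Fin.last _ := by simp [Fin.ext_iff]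
  have hdet : rectTwoDet h q A (B - 1) (X + 1) =
      ((Matrix.of fun j k : Fin (q + 2) => h ((if (j : ℕ) < q then A else
        if (j : ℕ) = q then X else B) - (j : ℤ) + (k : ℤ))).submatrix
          (Equiv.swap (⟨q, by omega⟩ : Fin (q + 2)) (Fin.last _)) id).det := by
    unfold rectTwoDet
    congr 1
    ext1 j k
    simp only [Matrix.of_apply, Matrix.submatrix_apply, id_eq]
    congr 1
    have hj := j.2
    rcases lt_trichotomy (j : ℕ) q with hlt | heq | hgt
    · rw [Equiv.swap_apply_of_ne_of_ne (by simp [Fin.ext_iff]; omega)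
        (by simp [Fin.ext_iff]; omega), if_pos hlt, if_pos hlt]
    · have : j = ⟨q, by omega⟩ := Fin.ext heq
      rw [this, Equiv.swap_apply_left]
      simp
      ring
    · have : j = Fin.last _ := by ext; simp; omega
      rw [this, Equiv.swap_apply_right]
      simp
  rw [hdet, Matrix.det_permute, Equiv.Perm.sign_swap hne, rectTwoDet]
  simp

/-- The generating function of the shifts of a sequence. -/
noncomputable def shiftSeries (c : ℤ) : PowerSeries R := PowerSeries.mk fun m => h (c - m)

lemma shiftSeries_eq (c : ℤ) :
    shiftSeries h c = PowerSeries.C (h c) + PowerSeries.X * shiftSeries h (c - 1) := by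
  ext m
  cases m with
  | zero => simp [shiftSeries]
  | succ m =>
    simp only [shiftSeries, PowerSeries.coeff_mk, map_add, PowerSeries.coeff_succ_X_mul,
      PowerSeries.coeff_C, Nat.add_eq_zero_iff, one_ne_zero, and_false, if_false, zero_add]
    congr 1
    push_cast; ring

/-- The generating function of `rectSkewDet` in the size of the removed row. -/
noncomputable def rectSkewSeries (B : ℤ) : PowerSeries R :=
  (Matrix.of fun j k : Fin (q + 2) => if (k : ℕ) = 0
    then shiftSeries h ((if (j : ℕ) ≤ q then A else B) - (j : ℤ))
    else PowerSeries.C (h ((if (j : ℕ) ≤ q then A else B) - (j : ℤ) + (k : ℤ)))).det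

lemma coeff_rectSkewSeries (B : ℤ) (m : ℕ) :
    PowerSeries.coeff m (rectSkewSeries h q A B) = rectSkewDet h q A m B := by
  have := coeff_det_updateCol (Matrix.of fun j k : Fin (q + 2) =>
    h ((if (j : ℕ) ≤ q then A else B) - (j : ℤ) + (k : ℤ))) 0
    (fun j => shiftSeries h ((if (j : ℕ) ≤ q then A else B) - (j : ℤ))) m
  rw [rectSkewSeries, rectSkewDet]
  convert this using 2
  · congr 1
    ext1 j k
    simp only [Matrix.of_apply, Matrix.updateCol_apply, Fin.ext_iff, Fin.val_zero, Matrix.map_apply]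
  · ext j k
    simp only [Matrix.of_apply, Matrix.updateCol_apply, Fin.ext_iff, Fin.val_zero, shiftSeries,
      PowerSeries.coeff_mk]
    by_cases hk : (k : ℕ) = 0
    · simp only [hk, if_true]
      congr 1
      push_cast; ring
    · simp only [hk, if_false, sub_zero]

/-- The two determinants differ in the last row only, so they combine linearly there; by
`shiftSeries_eq` the corner entry collapses to a constant. -/
lemma rectSkewSeries_sub (B : ℤ) :
    rectSkewSeries h q A (B + 1) - PowerSeries.X * rectSkewSeries h q A B =
      (Matrix.of fun j k : Fin (q + 2) => if (j : ℕ) ≤ q then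
          (if (k : ℕ) = 0 then shiftSeries h (A - (j : ℤ))
            else PowerSeries.C (h (A - (j : ℤ) + (k : ℤ))))
        else (if (k : ℕ) = 0 then PowerSeries.C (h (B + 1 - (j : ℤ)))
          else PowerSeries.C (h (B + 1 - (j : ℤ) + (k : ℤ))) -
            PowerSeries.X * PowerSeries.C (h (B - (j : ℤ) + (k : ℤ))))).det := by
  let N : ℤ → Matrix (Fin (q + 2)) (Fin (q + 2)) (PowerSeries R) := fun B =>
    Matrix.of fun j k : Fin (q + 2) => if (k : ℕ) = 0
    then shiftSeries h ((if (j : ℕ) ≤ q then A else B) - (j : ℤ))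
    else PowerSeries.C (h ((if (j : ℕ) ≤ q then A else B) - (j : ℤ) + (k : ℤ)))
  have hN (B B' : ℤ) : N B = (N B').updateRow (Fin.last _) (N B (Fin.last _)) := by
    ext1 j k
    refine Fin.lastCases ?_ (fun j => ?_) j
    · simp
    · have := j.2
      rw [Matrix.updateRow_ne (Fin.castSucc_lt_last j).ne]
      have : (j : ℕ) ≤ q := by omega
      simp [N, this]
  change (N (B + 1)).det - PowerSeries.X * (N B).det = _
  rw [hN (B + 1) B, sub_eq_add_neg, ← neg_mul]
  nth_rw 2 [hN B B]
  rw [← Matrix.det_updateRow_smul, ← Matrix.det_updateRow_add]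
  congr 1
  ext1 j k
  refine Fin.lastCases ?_ (fun j => ?_) j
  · rw [Matrix.updateRow_self]
    simp only [N, Pi.add_apply, Pi.smul_apply, Matrix.of_apply, Fin.val_last, smul_eq_mul]
    have hq : ¬ q + 1 ≤ q := by omega
    simp only [if_neg hq]
    split_ifs
    · rw [shiftSeries_eq, show B + 1 - ((q + 1 : ℕ) : ℤ) - 1 = B - ((q + 1 : ℕ) : ℤ) by ring]
      ring
    · ring
  · have := j.2
    rw [Matrix.updateRow_ne (Fin.castSucc_lt_last j).ne]
    have : (j : ℕ) ≤ q := by omega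
    simp [N, this]

lemma rectSkewSeries_sub_eq_det (B : ℤ) :
    rectSkewSeries h q A (B + 1) - PowerSeries.X * rectSkewSeries h q A B =
      (Matrix.of fun j k : Fin (q + 2) => if (j : ℕ) ≤ q then
          shiftSeries h (A - (j : ℤ) + (k : ℤ))
        else PowerSeries.C (h (B + 1 - (j : ℤ) + (k : ℤ)))).det := by
  rw [rectSkewSeries_sub]
  symm
  -- Adding `X` times each new column to the next one completes the upper rows to full series and
  -- cancels the `X` terms of the last row.
  refine Matrix.det_eq_of_forall_col_eq_smul_add_pred (fun _ => PowerSeries.X) ?_ ?_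
  · intro i
    simp
  · intro i k
    simp only [Matrix.of_apply, Fin.val_succ, Fin.val_castSucc, Nat.add_eq_zero_iff, one_ne_zero,
      and_false, if_false]
    push_cast
    split_ifs
    · rw [shiftSeries_eq]
      congr 3
      ring
    · rw [show B - (i : ℤ) + ((k : ℤ) + 1) = B + 1 - i + k by ring]
      ring

/-- Subtracting `X` times row `j + 1` from row `j`, for `j < q`, leaves row `q` as the only one that
is not constant. Taking the coefficient of `X^m` then lowers the part of row `q` by `m`. -/
lemma coeff_rectSkewSeries_sub (B : ℤ) (m : ℕ) :
    PowerSeries.coeff m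
      (rectSkewSeries h q A (B + 1) - PowerSeries.X * rectSkewSeries h q A B) =
      rectTwoDet h q A (A - m) (B + 1) := by
  have h1 : (Matrix.of fun j k : Fin (q + 2) => if (j : ℕ) ≤ q then
          shiftSeries h (A - (j : ℤ) + (k : ℤ))
        else PowerSeries.C (h (B + 1 - (j : ℤ) + (k : ℤ)))).det =
      (((Matrix.of fun j k : Fin (q + 2) =>
        h ((if (j : ℕ) ≤ q then A else B + 1) - (j : ℤ) + (k : ℤ))).map PowerSeries.C).updateRow
          ⟨q, by omega⟩ (fun k => shiftSeries h (A - q + (k : ℤ)))).det := by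
    rw [← Matrix.det_submatrix_equiv_self Fin.revPerm, ← Matrix.det_submatrix_equiv_self Fin.revPerm
      (Matrix.updateRow _ _ _)]
    -- Rows are reversed because each is corrected by the one below it; the multiplier `0` leaves
    -- row `q` untouched by the last row.
    refine Matrix.det_eq_of_forall_row_eq_smul_add_pred
      (fun i => if (i : ℕ) = 0 then 0 else PowerSeries.X) ?_ ?_
    · intro k
      simp [Matrix.updateRow_apply, Fin.ext_iff]
    · intro i k
      have hi := i.2
      simp only [Matrix.submatrix_apply, Fin.revPerm_apply, Matrix.of_apply, Matrix.updateRow_apply,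
        Matrix.map_apply, Fin.ext_iff, Fin.val_rev, Fin.val_succ, Fin.val_castSucc]
      rw [if_pos (by omega)]
      by_cases h0 : (i : ℕ) = 0
      · rw [if_pos (by omega), if_pos h0, zero_mul, add_zero]
        congr 3
        omega
      · rw [if_neg (by omega), if_neg h0, if_pos (by omega), shiftSeries_eq]
        congr 3
        rw [if_pos (by omega)]
        congr 1
        omega
  rw [rectSkewSeries_sub_eq_det, h1, coeff_det_updateRow, rectTwoDet]
  congr 1
  ext1 j k
  simp only [Matrix.updateRow_apply, Matrix.of_apply, Fin.ext_iff, shiftSeries,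
    PowerSeries.coeff_mk]
  split_ifs <;> first | omega | (congr 1 <;> omega)

lemma rectSkewDet_succ_succ (m : ℕ) (B : ℤ) :
    rectSkewDet h q A (m + 1 : ℕ) (B + 1) =
      rectSkewDet h q A m B + rectTwoDet h q A (A - (m + 1 : ℕ)) (B + 1) := by
  rw [← coeff_rectSkewSeries_sub, map_sub, PowerSeries.coeff_succ_X_mul, coeff_rectSkewSeries,
    coeff_rectSkewSeries]
  ring

lemma rectSkewDet_zero_left (B : ℤ) : rectSkewDet h q A 0 B = rectTwoDet h q A A B := by
  unfold rectSkewDet rectTwoDet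
  congr 2
  ext j k
  congr 1
  split_ifs <;> omega

/-- With an empty last part the last row vanishes except on the diagonal, and the remaining minors
agree by rotating the shape. -/
lemma rectSkewDet_zero_right (hneg : ∀ k < 0, h k = 0) (m : ℕ) :
    rectSkewDet h q A m 0 = rectTwoDet h q A (A - m) 0 := by
  unfold rectSkewDet rectTwoDet
  rw [Matrix.det_succ_row _ (Fin.last _), Matrix.det_succ_row _ (Fin.last _),
    Finset.sum_eq_single (Fin.last _), Finset.sum_eq_single (Fin.last _)]
  · congr 1
    · simp
    · simp only [Fin.succAbove_last]
      symm
      trans (Matrix.of fun j k : Fin (q + 1) =>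
        h ((A - if (k : ℕ) = 0 then (m : ℤ) else 0) - (j : ℤ) + (k : ℤ))).det
      · refine Eq.trans ?_ (det_of_rev_rev fun j k : Fin (q + 1) =>
        h ((A - if (k : ℕ) = 0 then (m : ℤ) else 0) - (j : ℤ) + (k : ℤ)))
        congr 1
        ext1 j k
        have hj := j.2
        have hk := k.2
        simp only [Matrix.submatrix_apply, Matrix.of_apply, Fin.val_castSucc, Fin.val_rev]
        congr 1
        split_ifs <;> omega
      · congr 1
        ext1 j k
        have hj := j.2
        simp only [Matrix.submatrix_apply, Matrix.of_apply, Fin.val_castSucc]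
        simp only [show (j : ℕ) ≤ q by omega, if_true]
  · intro k _ hk
    have hk' : (k : ℕ) < q + 1 := Fin.val_lt_last hk
    rw [Matrix.of_apply, hneg _ (by simp only [Fin.val_last]; split_ifs <;> omega)]
    simp
  · simp
  · intro k _ hk
    have hk' : (k : ℕ) < q + 1 := Fin.val_lt_last hk
    rw [Matrix.of_apply, hneg _ (by simp only [Fin.val_last]; split_ifs <;> omega)]
    simp
  · simp

/-- Removing a one-row shape from a rectangle with an additional row. -/
lemma rectSkewDet_eq_sum (hneg : ∀ k < 0, h k = 0) (N m B : ℕ) (hm : m ≤ N) (hB : B ≤ N) :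
    rectSkewDet h q N m B =
      ∑ k ∈ Finset.Icc (B - m) (min (N - m) B), rectTwoDet h q N ((N : ℤ) + B - m - k) k := by
  induction m generalizing B with
  | zero =>
    simp [rectSkewDet_zero_left, hB]
  | succ m ih =>
    obtain _ | B := B
    · have := rectSkewDet_zero_right h q N hneg (m + 1)
      simpa using this
    · have h1 : rectSkewDet h q N (m + 1 : ℕ) (B + 1 : ℕ) = _ :=
        rectSkewDet_succ_succ h q N m B
      rw [h1, ih B (by omega) (by omega), Nat.add_sub_add_right]
      have h2 (k : ℕ) : ((N : ℤ) + (B + 1 : ℕ) - (m + 1 : ℕ) - k) = (N : ℤ) + B - m - k := by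
        push_cast; ring
      simp only [h2]
      -- The extra determinant is the new top summand, or zero, or, after straightening, minus the
      -- old top summand, according to how the upper limit moves.
      rcases lt_trichotomy (B + 1) (N - m) with hlt | heq | hgt
      · rw [show min (N - m) B = B by omega, show min (N - (m + 1)) (B + 1) = B + 1 by omega,
          Finset.sum_Icc_succ_top (by omega)]
        congr 2
        push_cast; ring
      · rw [show min (N - m) B = B by omega, show min (N - (m + 1)) (B + 1) = B by omega,
          show (N : ℤ) - (m + 1 : ℕ) = B by omega, rectTwoDet_self_add_one, add_zero]
      · obtain ⟨u, hu⟩ : ∃ u, N = m + 1 + u := ⟨N - (m + 1), by omega⟩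
        rw [show min (N - m) B = u + 1 by omega, show min (N - (m + 1)) (B + 1) = u by omega,
          Finset.sum_Icc_succ_top (by omega)]
        have e1 : (N : ℤ) + B - m - (u + 1 : ℕ) = B := by omega
        have e2 : (N : ℤ) - (m + 1 : ℕ) = u := by omega
        rw [e1, e2, rectTwoDet_swap h q N u]
        push_cast
        rw [add_sub_cancel_right]
        ring

end Pieri

/-! ### Evaluated Schur polynomials as scalar determinants -/

lemma part_append (l l' : List ℕ) (j : ℕ) :
    part (l ++ l') j = if j < l.length then part l j else part l' (j - l.length) := by
  unfold part
  split_ifs with h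
  · exact List.getD_append _ _ _ _ h
  · exact List.getD_append_right _ _ _ _ (not_lt.1 h)

lemma part_replicate (p x j : ℕ) : part (List.replicate p x) j = if j < p then x else 0 := by
  unfold part
  split_ifs with h
  · simp [List.getD_eq_getElem?_getD, h]
  · simp [List.getD_eq_getElem?_getD, h]

lemma part_nil (j : ℕ) : part [] j = 0 := rfl

lemma part_singleton (x j : ℕ) : part [x] j = if j = 0 then x else 0 := by
  cases j <;> simp [part]

lemma part_pair (x y j : ℕ) : part [x, y] j = if j = 0 then x else if j = 1 then y else 0 := by
  obtain _ | _ | j := j <;> simp [part]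

section Eval
variable {w : ℕ} (z : Fin w → ℂ)

lemma eval_det_jacobiTrudi (l m : List ℕ) {N : ℕ} (hN : l.length = N) :
    MvPolynomial.eval z (jacobiTrudi w l m).det = (Matrix.of fun j k : Fin N =>
      MvPolynomial.eval z (completeHomogeneous w
        ((part l j : ℤ) - (part m k : ℤ) - (j : ℤ) + (k : ℤ)))).det := by
  subst hN
  rw [RingHom.map_det]
  rfl

lemma eval_schur (l : List ℕ) {N : ℕ} (hN : l.length = N) :
    MvPolynomial.eval z (schur w l) = (Matrix.of fun j k : Fin N =>
      MvPolynomial.eval z (completeHomogeneous w ((part l j : ℤ) - (j : ℤ) + (k : ℤ)))).det := by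
  rw [schur, skewSchur, if_pos (by simp [part_nil]), eval_det_jacobiTrudi z l [] hN]
  simp [part_nil]

lemma eval_completeHomogeneous_of_neg {k : ℤ} (hk : k < 0) :
    MvPolynomial.eval z (completeHomogeneous w k) = 0 := by
  rw [eval_completeHomogeneous, extCoeff_of_neg _ hk]

/-- The case distinction in `skewSchur` is harmless here: containment fails only for `p = 0` and `B
< m`, where the determinant is `h_(B-m) = 0`. -/
lemma eval_skewSchur_rect (p : ℕ) {A m : ℕ} (hm : m ≤ A) (B : ℕ) :
    MvPolynomial.eval z (skewSchur w (List.replicate p A ++ [B]) [m]) =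
      (Matrix.of fun j k : Fin (p + 1) => MvPolynomial.eval z (completeHomogeneous w
        ((if (j : ℕ) < p then (A : ℤ) else (B : ℤ)) - (if (k : ℕ) = 0 then (m : ℤ) else 0) -
          (j : ℤ) + (k : ℤ)))).det := by
  have hdet : MvPolynomial.eval z (jacobiTrudi w (List.replicate p A ++ [B]) [m]).det =
      (Matrix.of fun j k : Fin (p + 1) => MvPolynomial.eval z (completeHomogeneous w
        ((if (j : ℕ) < p then (A : ℤ) else (B : ℤ)) - (if (k : ℕ) = 0 then (m : ℤ) else 0) -
          (j : ℤ) + (k : ℤ)))).det := by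
    rw [eval_det_jacobiTrudi z _ _ (N := p + 1) (by simp)]
    congr 2
    ext j k
    have hj := j.2
    have h1 : part (List.replicate p A ++ [B]) j = if (j : ℕ) < p then A else B := by
      rw [part_append, part_replicate, part_singleton, List.length_replicate]
      split_ifs <;> first | rfl | omega
    rw [h1, part_singleton]
    push_cast
    rfl
  rw [skewSchur]
  split_ifs with hle
  · exact hdet
  · obtain _ | p := p
    · rw [map_zero]
      have : B < m := by
        by_contra hc
        refine hle fun j => ?_
        simp only [List.replicate_zero, List.nil_append, part_singleton]
        split_ifs <;> omega
      symm
      rw [Matrix.det_fin_one, Matrix.of_apply, eval_completeHomogeneous_of_neg]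
      simp
      omega
    · refine absurd (fun j => ?_) hle
      rw [part_append, part_replicate, part_singleton, List.length_replicate]
      split_ifs <;> omega

lemma eval_schur_rect_pair (q A X B : ℕ) :
    MvPolynomial.eval z (schur w (List.replicate q A ++ [X, B])) =
      rectTwoDet (fun k => MvPolynomial.eval z (completeHomogeneous w k)) q A X B := by
  rw [eval_schur z _ (N := q + 2) (by simp), rectTwoDet]
  congr 2
  ext j k
  have hj := j.2
  have h1 : part (List.replicate q A ++ [X, B]) j =
      if (j : ℕ) < q then A else if (j : ℕ) = q then X else B := by
    rw [part_append, part_replicate, part_pair, List.length_replicate]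
    split_ifs <;> first | rfl | omega
  rw [h1]
  push_cast
  rfl

end Eval

/-! ### The bordered minor: reflection, column shift, expansion -/

section Minors
variable {R : Type*} [CommRing R] (h : ℤ → R)

/-- Reflecting a skew shape with a rectangular outer part does not change its determinant. -/
lemma det_rect_reflect (p : ℕ) (A i j : ℤ) :
    (Matrix.of fun a b : Fin (p + 1) => h ((if (a : ℕ) < p then A else j) -
      (if (b : ℕ) = 0 then i else 0) - (a : ℤ) + (b : ℤ))).det =
    (Matrix.of fun a b : Fin (p + 1) => h ((if (a : ℕ) < p then A else A - i) -
      (if (b : ℕ) = 0 then A - j else 0) - (a : ℤ) + (b : ℤ))).det := by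
  rw [← det_of_rev_rev]
  congr 2
  ext a b
  have ha := a.2
  have hb := b.2
  simp only [Fin.val_rev]
  congr 1
  split_ifs <;> omega

/-- After transposition the border column comes last; cycling it past `p` columns to the front gives
the Jacobi-Trudi form and the sign. -/
lemma det_bordered_eq_det_rect (p : ℕ) (n i j : ℤ) :
    (Matrix.of fun a b : Fin (p + 1) => h ((if (a : ℕ) < p then n + (a : ℤ) else j) -
      (if (b : ℕ) < p then (b : ℤ) else (p : ℤ) + i))).det =
    (-1) ^ p * (Matrix.of fun a b : Fin (p + 1) => h ((if (a : ℕ) < p then n - 1 else n - 1 - i) -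
      (if (b : ℕ) = 0 then n - 1 - j else 0) - (a : ℤ) + (b : ℤ))).det := by
  have key := Matrix.det_permute' (finRotate (p + 1)) (Matrix.of fun a b : Fin (p + 1) =>
    h ((if (a : ℕ) < p then n - 1 else n - 1 - i) -
      (if (b : ℕ) = 0 then n - 1 - j else 0) - (a : ℤ) + (b : ℤ)))
  rw [sign_finRotate, Nat.add_sub_cancel] at key
  push_cast at key
  rw [← key, ← Matrix.det_transpose]
  congr 1
  ext1 a b
  have ha := a.2
  simp only [Matrix.transpose_apply, Matrix.submatrix_apply, Matrix.of_apply, id_eq]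
  congr 1
  refine Fin.lastCases ?_ (fun b => ?_) b
  · rw [finRotate_last]
    simp only [Fin.val_last, Fin.val_zero]
    split_ifs <;> omega
  · have hb := b.2
    rw [coe_finRotate_of_ne_last (Fin.castSucc_lt_last b).ne]
    simp only [Fin.val_castSucc]
    rw [if_neg (show ¬ (b : ℕ) + 1 = 0 from Nat.succ_ne_zero _)]
    split_ifs <;> omega

/-- Expansion of the bordered determinant along its last row. -/
lemma det_bordered_expand (p : ℕ) (n i j : ℤ) :
    (Matrix.of fun a b : Fin (p + 1) => h ((if (a : ℕ) < p then n + (a : ℤ) else j) -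
      (if (b : ℕ) < p then (b : ℤ) else (p : ℤ) + i))).det =
    h (j - i - p) * (Matrix.of fun a b : Fin p => h (n - (a : ℤ) + (b : ℤ))).det -
      ∑ k ∈ Finset.range p, (-1) ^ k * h (j + 1 + k - p) *
        (Matrix.of fun a b : Fin p => h ((if (a : ℕ) < p - k - 1 then n else
          if (a : ℕ) < p - 1 then n - 1 else n - 1 - i) - (a : ℤ) + (b : ℤ))).det := by
  rw [Matrix.det_succ_row _ (Fin.last p), Fin.sum_univ_castSucc, add_comm, sub_eq_add_neg]
  congr 1
  · congr 1
    · simp only [Fin.val_last, Matrix.of_apply, lt_irrefl, if_false]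
      rw [← two_mul, pow_mul, neg_one_sq, one_pow, one_mul]
      congr 1
      ring
    · rw [← Matrix.det_transpose]
      congr 1
      ext1 a b
      simp only [Fin.succAbove_last, Matrix.transpose_apply, Matrix.submatrix_apply,
        Matrix.of_apply, Fin.val_castSucc, Fin.is_lt, if_true]
      congr 1
      ring
  -- Reversed, the summand `k` deletes column `p - 1 - k`; the later columns move one place, which
  -- lowers their parts from `n` to `n - 1`.
  · rw [← Equiv.sum_comp Fin.revPerm, Finset.sum_range, ← Finset.sum_neg_distrib]
    refine Finset.sum_congr rfl fun k _ => ?_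
    have hk := k.2
    rw [← neg_mul, ← neg_mul]
    congr 1
    · congr 1
      · simp only [Fin.val_last, Fin.val_castSucc, Fin.revPerm_apply, Fin.val_rev]
        rw [show p + (p - (k + 1)) = 2 * (p - (k + 1)) + (k + 1) by omega, pow_add, pow_mul,
          neg_one_sq, one_pow, one_mul, pow_succ, mul_neg_one]
      · simp only [Fin.val_last, Matrix.of_apply, Fin.val_castSucc, Fin.revPerm_apply, Fin.val_rev]
        congr 1
        split_ifs <;> omega
    · rw [← Matrix.det_transpose]
      congr 1
      ext1 a b
      have ha := a.2
      simp only [Fin.succAbove_last, Matrix.transpose_apply, Matrix.submatrix_apply,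
        Matrix.of_apply, Fin.val_castSucc, Fin.is_lt, if_true, Fin.revPerm_apply]
      congr 1
      simp only [Fin.succAbove, Fin.lt_def, Fin.val_castSucc, Fin.val_rev, apply_ite Fin.val,
        Fin.val_succ]
      split_ifs <;> omega

end Minors

section Eval
variable {w : ℕ} (z : Fin w → ℂ)

lemma eval_schur_rect (p n : ℕ) :
    MvPolynomial.eval z (schur w (List.replicate p n)) = (Matrix.of fun a b : Fin p =>
      MvPolynomial.eval z (completeHomogeneous w ((n : ℤ) - (a : ℤ) + (b : ℤ)))).det := by
  rw [eval_schur z _ (N := p) (by simp)]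
  congr 2
  ext a b
  simp [part_replicate]

lemma eval_schur_rect_rect_singleton {p k : ℕ} (hk : k < p) {n i : ℕ} (hi : i < n) :
    MvPolynomial.eval z (schur w
      (List.replicate (p - k - 1) n ++ List.replicate k (n - 1) ++ [n - (i + 1)])) =
    (Matrix.of fun a b : Fin p => MvPolynomial.eval z (completeHomogeneous w
      ((if (a : ℕ) < p - k - 1 then (n : ℤ) else
          if (a : ℕ) < p - 1 then (n : ℤ) - 1 else (n : ℤ) - 1 - i) - (a : ℤ) + (b : ℤ)))).det := by
  rw [eval_schur z _ (N := p) (by simp; omega)]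
  congr 2
  ext a b
  have ha := a.2
  congr 4
  rw [part_append, part_append, part_replicate, part_replicate, part_singleton, List.length_append,
    List.length_replicate, List.length_replicate]
  split_ifs <;> omega

end Eval

/-! ### Assembly of the four formulas -/

/-- Cofactors of a banded Toeplitz matrix as determinants of complete homogeneous polynomials. -/
lemma adjugate_toeplitz (p w n : ℕ) (a : ℂ[T;T⁻¹]) (z : Fin w → ℂ)
    (ha : a = LaurentPolynomial.C (a.coeff (p : ℤ)) * LaurentPolynomial.T ((p : ℤ) - (w : ℤ)) *
      ∏ j : Fin w, (LaurentPolynomial.T 1 - LaurentPolynomial.C (z j))) (i j : Fin n) :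
    (toeplitz n a).adjugate i j = a.coeff (p : ℤ) ^ (n - 1) * ((-1) ^ (n * p) *
      (Matrix.of fun k l : Fin (p + 1) => MvPolynomial.eval z (completeHomogeneous w
        ((if (k : ℕ) < p then (n : ℤ) + (k : ℤ) else (j : ℤ)) -
          (if (l : ℕ) < p then (l : ℤ) else (p : ℤ) + (i : ℤ))))).det) := by
  set c := a.coeff (p : ℤ)
  have hT : toeplitz n a = c • (Matrix.of fun k l : Fin n =>
      extCoeff (∏ j, (1 - PowerSeries.C (z j) * PowerSeries.X)) ((p : ℤ) + k - l)).transpose := by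
    ext k l
    rw [toeplitz, Matrix.of_apply, ha, coeff_T_mul_prod]
    simp only [Matrix.smul_apply, Matrix.transpose_apply, Matrix.of_apply, smul_eq_mul]
    congr 2
    ring
  simp only [eval_completeHomogeneous]
  rw [hT, Matrix.adjugate_smul, ← Matrix.adjugate_transpose, Matrix.smul_apply,
    Matrix.transpose_apply, adjugate_extCoeff (prod_one_sub_mul_mk_eval_hsymm z)
      (by simp [map_prod]), Fintype.card_fin, smul_eq_mul]

end BandedToeplitz

theorem theorem2 (p w n : ℕ) (hw : 1 ≤ w) (hn : 1 ≤ n)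
    (a : ℂ[T;T⁻¹]) (z : Fin w → ℂ) (hap : a.coeff (p : ℤ) ≠ 0)
    (ha : a = LaurentPolynomial.C (a.coeff (p : ℤ)) * LaurentPolynomial.T ((p : ℤ) - (w : ℤ)) *
      ∏ j : Fin w, (LaurentPolynomial.T 1 - LaurentPolynomial.C (z j)))
    -- the row `r` and the column `s` are counted from `1`
    (i j : Fin n) (r s : ℕ) (hr : r = (i : ℕ) + 1) (hs : s = (j : ℕ) + 1) :
    ((BandedToeplitz.toeplitz n a).adjugate i j =
      (-1) ^ (p * (n - 1)) * a.coeff (p : ℤ) ^ (n - 1) *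
        MvPolynomial.eval z
          (BandedToeplitz.skewSchur w (List.replicate p (n - 1) ++ [s - 1]) [r - 1])) ∧
    ((BandedToeplitz.toeplitz n a).adjugate i j =
      (-1) ^ (p * (n - 1)) * a.coeff (p : ℤ) ^ (n - 1) *
        MvPolynomial.eval z
          (BandedToeplitz.skewSchur w (List.replicate p (n - 1) ++ [n - r]) [n - s])) ∧
    (1 ≤ p →
      (BandedToeplitz.toeplitz n a).adjugate i j =
        (-1) ^ (p * (n - 1)) * a.coeff (p : ℤ) ^ (n - 1) *
          ∑ k ∈ Finset.Icc (s - r) (min (n - r) (s - 1)),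
            MvPolynomial.eval z
              (BandedToeplitz.schur w
                (List.replicate (p - 1) (n - 1) ++ [n + s - r - 1 - k, k]))) ∧
    ((BandedToeplitz.toeplitz n a).adjugate i j =
      (-1) ^ (p * n) * a.coeff (p : ℤ) ^ (n - 1) *
        (MvPolynomial.eval z
            (BandedToeplitz.completeHomogeneous w ((s : ℤ) - (r : ℤ) - (p : ℤ))) *
          MvPolynomial.eval z (BandedToeplitz.schur w (List.replicate p n)) -
        ∑ k ∈ Finset.range p,
          (-1) ^ k *
            MvPolynomial.eval z
              (BandedToeplitz.completeHomogeneous w ((s : ℤ) + (k : ℤ) - (p : ℤ))) *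
            MvPolynomial.eval z
              (BandedToeplitz.schur w
                (List.replicate (p - k - 1) n ++ List.replicate k (n - 1) ++ [n - r])))) := by
  subst hr hs
  have hi := i.2
  have hj := j.2
  have hsign : ((-1 : ℂ)) ^ (n * p) * (-1) ^ p = (-1) ^ (p * (n - 1)) := by
    obtain ⟨m, rfl⟩ : ∃ m, n = m + 1 := ⟨n - 1, by omega⟩
    rw [Nat.add_sub_cancel, ← pow_add, show (m + 1) * p + p = p * m + 2 * p by ring, pow_add,
      pow_mul _ 2 p, neg_one_sq, one_pow, mul_one]
  have hcast : ((n - 1 : ℕ) : ℤ) = (n : ℤ) - 1 := by omega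
  have hadj := BandedToeplitz.adjugate_toeplitz p w n a z ha i j
  have second : (BandedToeplitz.toeplitz n a).adjugate i j =
      (-1) ^ (p * (n - 1)) * a.coeff (p : ℤ) ^ (n - 1) * MvPolynomial.eval z
        (BandedToeplitz.skewSchur w (List.replicate p (n - 1) ++ [n - ((i : ℕ) + 1)])
          [n - ((j : ℕ) + 1)]) := by
    rw [hadj, BandedToeplitz.det_bordered_eq_det_rect
      (fun k => MvPolynomial.eval z (BandedToeplitz.completeHomogeneous w k)), ← mul_assoc,
      ← mul_assoc, ← hsign, BandedToeplitz.eval_skewSchur_rect z p (by omega), hcast,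
      show ((n - ((i : ℕ) + 1) : ℕ) : ℤ) = (n : ℤ) - 1 - i by omega,
      show ((n - ((j : ℕ) + 1) : ℕ) : ℤ) = (n : ℤ) - 1 - j by omega]
    ring
  have first : (BandedToeplitz.toeplitz n a).adjugate i j =
      (-1) ^ (p * (n - 1)) * a.coeff (p : ℤ) ^ (n - 1) * MvPolynomial.eval z
        (BandedToeplitz.skewSchur w (List.replicate p (n - 1) ++ [(j : ℕ) + 1 - 1])
          [(i : ℕ) + 1 - 1]) := by
    rw [second, BandedToeplitz.eval_skewSchur_rect z p (by omega),
      BandedToeplitz.eval_skewSchur_rect z p (by omega), BandedToeplitz.det_rect_reflect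
        (fun k => MvPolynomial.eval z (BandedToeplitz.completeHomogeneous w k)), hcast,
      show ((n - ((i : ℕ) + 1) : ℕ) : ℤ) = (n : ℤ) - 1 - i by omega,
      show ((n - ((j : ℕ) + 1) : ℕ) : ℤ) = (n : ℤ) - 1 - j by omega]
    simp only [sub_sub_cancel, Nat.add_sub_cancel]
  refine ⟨first, second, fun hp => ?_, ?_⟩
  · obtain ⟨q, rfl⟩ : ∃ q, p = q + 1 := ⟨p - 1, by omega⟩
    rw [first, BandedToeplitz.eval_skewSchur_rect z _ (by omega)]
    congr 1
    have key := BandedToeplitz.rectSkewDet_eq_sum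
      (fun k => MvPolynomial.eval z (BandedToeplitz.completeHomogeneous w k)) q
      (fun k hk => BandedToeplitz.eval_completeHomogeneous_of_neg z hk) (n - 1) i j
      (by omega) (by omega)
    simp only [Nat.add_sub_cancel, Nat.lt_succ_iff]
    -- Truncated subtraction in the lower limit plays the role of `max(0, s - r)`.
    refine key.trans (Finset.sum_congr ?_ fun k hk => ?_)
    · congr 1 <;> omega
    · rw [Finset.mem_Icc] at hk
      rw [BandedToeplitz.eval_schur_rect_pair]
      congr 1
      omega
  · rw [hadj, BandedToeplitz.det_bordered_expand
      (fun k => MvPolynomial.eval z (BandedToeplitz.completeHomogeneous w k)),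
      BandedToeplitz.eval_schur_rect, ← mul_assoc, mul_comm (a.coeff (p : ℤ) ^ (n - 1)),
      mul_comm n p]
    congr 2
    · congr 3
      push_cast; ring
    · refine Finset.sum_congr rfl fun k hk => ?_
      rw [BandedToeplitz.eval_schur_rect_rect_singleton z (Finset.mem_range.1 hk) hi]
      push_cast
      rfl
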